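/- Let $p\ge q\ge 2$ and $k\ge 2$ be integers, let $c_1,\dots,c_k$ be distinct nonzero complex numbers, and let $A_0,\dots,A_k,A_{k+1}$ be meromorphic functions on $\mathbb C$. Write $\log_0 x=x$, $\log_{n+1}x=\log(\log_n x)$, let $T(r,g)$ be the Nevanlinna characteristic of a meromorphic function $g$ on $\mathbb C$ and $N(r,g)$ the integrated counting function of its poles, and put $$\rho_g=\limsup_{r\to\infty}\frac{\log_p T(r,g)}{\log_q r},\qquad \underline\rho_g=\liminf_{r\to\infty}\frac{\log_p T(r,g)}{\log_q r},\qquad \lambda_{1/g}=\limsup_{r\to\infty}\frac{\log_p N(r,g)}{\log_q r}$$ (the $(p,q)$-order, the $(p,q)$-lower order and the $(p,q)$-exponent of convergence of the poles; $\rho_g=\underline\rho_g=0$ if $g$ is constant, and $\lambda_{1/g}=0$ if $g$ has no poles). If $0<\rho_g<\infty$, respectively $0<\underline\rho_g<\infty$, let $$\tau_g=\limsup_{r\to\infty}\frac{\log_{p-1}T(r,g)}{(\log_{q-1}r)^{\rho_g}},\qquad \underline\tau_g=\liminf_{r\to\infty}\frac{\log_{p-1}T(r,g)}{(\log_{q-1}r)^{\underline\rho_g}}$$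 be the $(p,q)$-type, respectively the $(p,q)$-lower type. Suppose that there are $l,m\in\{0,1,\dots,k+1\}$ such that, with $j$ ranging over $\{0,\dots,k+1\}$ and $M=\max\{\rho_{A_j}: j\ne m,l\}$, the following hold: 1. $0<\max\{\underline\rho_{A_m},M\}\le\underline\rho_{A_l}<\infty$; 2. if $\underline\rho_{A_l}=\underline\rho_{A_m}$, then $\underline\tau_{A_l}>\underline\tau_{A_m}$; 3. if $\underline\rho_{A_l}=M$, then $\displaystyle\sum_{j\ne m,l,\ \rho_{A_j}=\underline\rho_{A_l}}\tau_{A_j}<\underline\tau_{A_l}<\infty$; 4. if $\underline\rho_{A_l}=\underline\rho_{A_m}=M$, then $\displaystyle\sum_{j\ne m,l,\ \rho_{A_j}=\underline\rho_{A_l}}\tau_{A_j}+\underline\tau_{A_m}<\underline\tau_{A_l}<\infty$; 5. $\lambda_{1/A_l}<\underline\rho_{A_l}$. Then every meromorphic function $f\not\equiv0$ on $\mathbb C$ that satisfies $$A_k(z)f(z+c_k)+A_{k-1}(z)f(z+c_{k-1})+\cdots+A_1(z)f(z+c_1)+A_0(z)f(z)=A_{k+1}(z)$$ has $(p,q)$-order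 $\rho_f\ge\underline\rho_{A_l}$. (The case $A_{k+1}\equiv0$ is included.) -/

import Mathlib

/-- The iterated logarithm `log_k x`, with `log_0 x = x` and `log_{k+1} x = log (log_k x)`.
It is only used along `x → ∞`. -/
noncomputable def iterLog (k : ℕ) (x : ℝ) : ℝ := Real.log^[k] x

/-- The Nevanlinna characteristic function `T(r, f) = m(r, f) + N(r, f)`. -/
noncomputable def nevanlinnaT (f : ℂ → ℂ) (r : ℝ) : ℝ :=
  ValueDistribution.characteristic f ⊤ r

/-- The integrated counting function `N(r, f)` of the poles of `f` in `|z| ≤ r`,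
counted with multiplicity. -/
noncomputable def nevanlinnaN (f : ℂ → ℂ) (r : ℝ) : ℝ :=
  ValueDistribution.logCounting f ⊤ r

/-- The `(p,q)`-order of a meromorphic function:
`limsup_{r → ∞} log_p T(r, f) / log_q r`, an extended real number. -/
noncomputable def pqOrder (p q : ℕ) (f : ℂ → ℂ) : EReal :=
  Filter.limsup (fun r : ℝ ↦ ((iterLog p (nevanlinnaT f r) / iterLog q r : ℝ) : EReal))
    Filter.atTop

/-- The `(p,q)`-lower order of a meromorphic function:
`liminf_{r → ∞} log_p T(r, f) / log_q r`. -/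
noncomputable def pqLowerOrder (p q : ℕ) (f : ℂ → ℂ) : EReal :=
  Filter.liminf (fun r : ℝ ↦ ((iterLog p (nevanlinnaT f r) / iterLog q r : ℝ) : EReal))
    Filter.atTop

/-- The `(p,q)`-type of a meromorphic function whose `(p,q)`-order `ρ` is positive and finite:
`limsup_{r → ∞} log_{p-1} T(r, f) / (log_{q-1} r) ^ ρ`. -/
noncomputable def pqType (p q : ℕ) (f : ℂ → ℂ) : EReal :=
  Filter.limsup (fun r : ℝ ↦
    ((iterLog (p - 1) (nevanlinnaT f r) / iterLog (q - 1) r ^ (pqOrder p q f).toReal : ℝ) : EReal))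
    Filter.atTop

/-- The `(p,q)`-lower type of a meromorphic function whose `(p,q)`-lower order `μ` is positive and
finite: `liminf_{r → ∞} log_{p-1} T(r, f) / (log_{q-1} r) ^ μ`. -/
noncomputable def pqLowerType (p q : ℕ) (f : ℂ → ℂ) : EReal :=
  Filter.liminf (fun r : ℝ ↦
    ((iterLog (p - 1) (nevanlinnaT f r) /
      iterLog (q - 1) r ^ (pqLowerOrder p q f).toReal : ℝ) : EReal))
    Filter.atTop

/-- The `(p,q)`-exponent of convergence of the sequence of poles of a meromorphic function:
`limsup_{r → ∞} log_p N(r, f) / log_q r`. -/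
noncomputable def pqPoleExponent (p q : ℕ) (f : ℂ → ℂ) : EReal :=
  Filter.limsup (fun r : ℝ ↦ ((iterLog p (nevanlinnaN f r) / iterLog q r : ℝ) : EReal))
    Filter.atTop

/-- The largest `(p,q)`-order among the coefficients `A_j`, `0 ≤ j ≤ k + 1`, `j ≠ m, l`. -/
noncomputable def maxOtherOrder (p q k m l : ℕ) (A : ℕ → ℂ → ℂ) : EReal :=
  (Finset.range (k + 2) \ {m, l}).sup (fun j ↦ pqOrder p q (A j))

open Classical in
/-- The sum of the `(p,q)`-types of those `A_j`, `0 ≤ j ≤ k + 1`, `j ≠ m, l`, whose `(p,q)`-order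
equals the `(p,q)`-lower order of `A_l`. -/
noncomputable def tiedTypeSum (p q k m l : ℕ) (A : ℕ → ℂ → ℂ) : EReal :=
  ∑ j ∈ (Finset.range (k + 2) \ {m, l}).filter
    (fun j ↦ pqOrder p q (A j) = pqLowerOrder p q (A l)), pqType p q (A j)

/-- `f` solves the linear difference equation
`A_k(z) f(z + c_k) + ⋯ + A_1(z) f(z + c_1) + A_0(z) f(z) = A_{k+1}(z)`
as an identity between meromorphic functions, i.e. outside a closed discrete set (the functions
take arbitrary values at their poles). -/
def SolvesDifferenceEquation (k : ℕ) (A : ℕ → ℂ → ℂ) (c : ℕ → ℂ) (f : ℂ → ℂ) : Prop :=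
  (fun z ↦ ∑ j ∈ Finset.Icc 1 k, A j z * f (z + c j) + A 0 z * f z)
    =ᶠ[Filter.codiscrete ℂ] A (k + 1)

section

open Filter Topology Real

/-! Put n = p - 1 and s = q - 1. Solving the equation for A_l and taking characteristics gives T(r,
A_l) ≤ ∑_{j ≠ l} T(r, A_j) + K T(Cr, f) + K (`exists_nevanlinnaT_coeff_le`). The shifts cost only a
dilation of r: by Cartan's formula T is an average of counting functions, and these are compared
point by point (`exists_characteristic_comp_add_le`).

All growth is measured against one scale exp^[n](H), H(r) = σ (log_s r)^ν, that separates A_l from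
the other coefficients. If ρ_f < ν, every characteristic on the right is at most exp^[n](H), while
T(r, A_l) ≥ exp^[n](κH) with some κ > 1. As n ≥ 1, the latter outgrows every affine function of
exp^[n](H) (`eventually_affine_iterExp_lt`), a contradiction. All bounds but that on A_m hold for
all large r, so A_m may be small merely for arbitrarily large r; hence its lower order and lower
type suffice.

With μ the lower order of A_l, the scale has ν = μ and σ between the types if A_l is tied with
another coefficient, and otherwise ν < μ and σ = 1. -/

/-! ### Iterated logarithms and exponentials -/

theorem tendsto_iterLog_atTop (n : ℕ) : Tendsto (iterLog n) atTop atTop := by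
  induction n with
  | zero => exact tendsto_id
  | succ n ih =>
    have : iterLog (n + 1) = Real.log ∘ iterLog n := by
      funext x; simp only [iterLog, Function.iterate_succ_apply', Function.comp]
    rw [this]; exact tendsto_log_atTop.comp ih

theorem iterLog_succ (n : ℕ) (x : ℝ) : iterLog (n + 1) x = Real.log (iterLog n x) := by
  simp only [iterLog, Function.iterate_succ_apply']

theorem tendsto_iterExp_atTop (n : ℕ) : Tendsto (Real.exp^[n]) atTop atTop := by
  induction n with
  | zero => simpa using tendsto_id
  | succ n ih => rw [Function.iterate_succ]; exact ih.comp tendsto_exp_atTop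

theorem strictMono_iterExp (n : ℕ) : StrictMono (Real.exp^[n]) :=
  Real.exp_strictMono.iterate n

theorem eventually_iterExp_iterLog (n : ℕ) : ∀ᶠ T in atTop, Real.exp^[n] (iterLog n T) = T := by
  induction n with
  | zero => simp [iterLog]
  | succ n ih =>
    filter_upwards [tendsto_log_atTop.eventually ih, eventually_gt_atTop 0] with T hT h0
    rw [Function.iterate_succ_apply', iterLog, Function.iterate_succ_apply]
    rw [iterLog] at hT
    rw [hT, Real.exp_log h0]

/-- For `n ≥ 1` and `κ > 1`, the iterated exponential at `κ * H` eventually exceeds every affine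
function of its value at `H`. -/
theorem eventually_affine_iterExp_lt {n : ℕ} (hn : n ≠ 0) {κ : ℝ} (hκ : 1 < κ) (K : ℝ) :
    ∀ᶠ H in atTop, K * Real.exp^[n] H + K < Real.exp^[n] (κ * H) := by
  obtain ⟨n, rfl⟩ := Nat.exists_eq_succ_of_ne_zero hn
  induction n generalizing K with
  | zero =>
    have h1 : Tendsto (fun H : ℝ ↦ (κ - 1) * H) atTop atTop :=
      tendsto_id.const_mul_atTop (by linarith)
    filter_upwards [(tendsto_exp_atTop.comp h1).eventually_gt_atTop (2 * |K|),
      eventually_ge_atTop 0] with H hH h0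
    simp only [Function.comp, Nat.succ_eq_add_one, zero_add, Function.iterate_one] at *
    have h2 : Real.exp (κ * H) = Real.exp ((κ - 1) * H) * Real.exp H := by
      rw [← Real.exp_add]; ring_nf
    have h3 := Real.one_le_exp h0
    rw [h2]
    nlinarith [le_abs_self K, abs_nonneg K]
  | succ n ih =>
    -- Doubling the inner value squares the outer one, so the constant 2 serves for every K: E * E
    -- exceeds K * E + K once E > 2|K| and E ≥ 1.
    filter_upwards [ih 2 (by simp), (tendsto_iterExp_atTop (n + 1 + 1)).eventually_gt_atTop (2 * |K|),
      (tendsto_iterExp_atTop (n + 1 + 1)).eventually_ge_atTop 1] with H h1 h2 h3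
    simp only [Nat.succ_eq_add_one] at *
    rw [Function.iterate_succ_apply' _ (n + 1)] at h2 h3 ⊢
    rw [Function.iterate_succ_apply' _ (n + 1)]
    set E := Real.exp (Real.exp^[n + 1] H)
    have h4 : E * E ≤ Real.exp (Real.exp^[n + 1] (κ * H)) := by
      rw [← Real.exp_add]; apply Real.exp_le_exp.2; linarith
    nlinarith [le_abs_self K, abs_nonneg K]

/-- A function that is eventually constant or tends to infinity. -/
def ConstOrTendsto (T : ℝ → ℝ) : Prop :=
  Tendsto T atTop atTop ∨ ∃ C, ∀ᶠ r in atTop, T r = C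

/-- Iterated logarithms of a bounded T may be junk values that exponentials do not undo. A constant
T is harmless, being eventually below exp^[n](H) in any case. -/
theorem ConstOrTendsto.eventually_le_of_le {T H : ℝ → ℝ} (hT : ConstOrTendsto T) (n : ℕ)
    (hH : Tendsto H atTop atTop) :
    ∀ᶠ r in atTop, iterLog n (T r) ≤ H r → T r ≤ Real.exp^[n] (H r) := by
  rcases hT with hT | ⟨C, hC⟩
  · filter_upwards [hT.eventually (eventually_iterExp_iterLog n)] with r h1 h2
    rw [← h1]
    exact (strictMono_iterExp n).monotone h2
  · filter_upwards [hC, ((tendsto_iterExp_atTop n).comp hH).eventually_ge_atTop C] with r h1 h2 _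
    rw [h1]; exact h2

theorem Filter.Tendsto.eventually_le_of_le_iterLog {T H : ℝ → ℝ} (hT : Tendsto T atTop atTop) (n : ℕ) :
    ∀ᶠ r in atTop, H r ≤ iterLog n (T r) → Real.exp^[n] (H r) ≤ T r := by
  filter_upwards [hT.eventually (eventually_iterExp_iterLog n)] with r h1 h2
  rw [← h1]
  exact (strictMono_iterExp n).monotone h2

/-- With x = log_{q-1} r, this passes from the scale of orders to the scale of types. -/
theorem iterExp_succ_log_rpow (n : ℕ) {x : ℝ} (hx : 0 < x) (β : ℝ) :
    Real.exp^[n + 1] (β * Real.log x) = Real.exp^[n] (x ^ β) := by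
  rw [Function.iterate_succ_apply, mul_comm, Real.rpow_def_of_pos hx]

/-- A logarithm turns any factor K into a summand log K, which is eventually absorbed. At n = 0 the
factor is still C. -/
theorem eventually_iterLog_const_mul_le {n : ℕ} (hn : n ≠ 0) {C : ℝ} (hC : 0 < C) :
    ∀ᶠ r in atTop, iterLog n (C * r) ≤ 2 * iterLog n r := by
  obtain ⟨n, rfl⟩ := Nat.exists_eq_succ_of_ne_zero hn
  have step : ∀ n : ℕ, ∀ K > (0 : ℝ), (∀ᶠ r in atTop, iterLog n (C * r) ≤ K * iterLog n r) →
      ∀ᶠ r in atTop, iterLog (n + 1) (C * r) ≤ 2 * iterLog (n + 1) r := by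
    intro n K hK h
    have hCr : Tendsto (fun r : ℝ ↦ C * r) atTop atTop := tendsto_id.const_mul_atTop hC
    filter_upwards [h, (tendsto_iterLog_atTop n).eventually_gt_atTop 0,
      ((tendsto_iterLog_atTop n).comp hCr).eventually_gt_atTop 0,
      (tendsto_iterLog_atTop (n + 1)).eventually_ge_atTop (Real.log K)] with r h1 h2 h3 h4
    rw [iterLog_succ] at h4 ⊢
    rw [iterLog_succ]
    have := Real.log_le_log h3 h1
    rw [Real.log_mul hK.ne' h2.ne'] at this
    simp only [Function.comp] at this
    linarith
  induction n with
  | zero => exact step 0 C hC (by simp [iterLog])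
  | succ n ih => exact step _ 2 two_pos (ih (by simp))

/-- The power `(log_{q-1} r) ^ β` absorbs a dilation of `r` at the cost of raising the exponent. -/
theorem eventually_iterLog_const_mul_rpow_le {n : ℕ} (hn : n ≠ 0) {C β β' : ℝ} (hC : 0 < C)
    (hβ : 0 < β) (hβ' : β < β') :
    ∀ᶠ r in atTop, iterLog n (C * r) ^ β ≤ iterLog n r ^ β' := by
  have hCr : Tendsto (fun r : ℝ ↦ C * r) atTop atTop := tendsto_id.const_mul_atTop hC
  have h1 : Tendsto (fun r ↦ iterLog n r ^ (β' - β)) atTop atTop :=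
    (tendsto_rpow_atTop (by linarith)).comp (tendsto_iterLog_atTop n)
  filter_upwards [eventually_iterLog_const_mul_le hn hC, h1.eventually_ge_atTop (2 ^ β),
    (tendsto_iterLog_atTop n).eventually_gt_atTop 0,
    ((tendsto_iterLog_atTop n).comp hCr).eventually_gt_atTop 0] with r h2 h3 h4 h5
  calc iterLog n (C * r) ^ β ≤ (2 * iterLog n r) ^ β := Real.rpow_le_rpow h5.le h2 hβ.le
    _ = 2 ^ β * iterLog n r ^ β := Real.mul_rpow two_pos.le h4.le
    _ ≤ iterLog n r ^ (β' - β) * iterLog n r ^ β := by gcongr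
    _ = iterLog n r ^ β' := by rw [← Real.rpow_add h4]; ring_nf

theorem tendsto_iterLog_rpow (n : ℕ) {β : ℝ} (hβ : 0 < β) :
    Tendsto (fun r ↦ iterLog n r ^ β) atTop atTop :=
  (tendsto_rpow_atTop hβ).comp (tendsto_iterLog_atTop n)

theorem eventually_mul_iterLog_rpow_le (n : ℕ) {β β' K σ : ℝ} (hβ' : β < β') (hσ : 0 < σ) :
    ∀ᶠ r in atTop, K * iterLog n r ^ β ≤ σ * iterLog n r ^ β' := by
  filter_upwards [(tendsto_iterLog_rpow n (sub_pos.2 hβ')).eventually_ge_atTop (K / σ),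
    (tendsto_iterLog_atTop n).eventually_gt_atTop 0] with r h1 h2
  rw [div_le_iff₀ hσ] at h1
  calc K * iterLog n r ^ β ≤ (iterLog n r ^ (β' - β) * σ) * iterLog n r ^ β := by gcongr
    _ = σ * (iterLog n r ^ (β' - β) * iterLog n r ^ β) := by ring
    _ = σ * iterLog n r ^ β' := by rw [← Real.rpow_add h2]; ring_nf

/-! ### Characteristic of a translate -/

open scoped Pointwise
open Function.locallyFinsuppWithin MeromorphicOn ValueDistribution Metric

/-- The weight of the point `z` in the logarithmic counting function at radius `r`. -/
noncomputable def countingWeight (r : ℝ) (z : ℂ) : ℝ :=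
  if z = 0 then Real.log r else log⁺ (r * ‖z‖⁻¹)

/-- The set `s` is left free so that different divisors and radii can share one index set. -/
theorem logCounting_eq_sum_countingWeight (D : Function.locallyFinsupp ℂ ℤ) {r : ℝ} (hr : 0 < r)
    (s : Finset ℂ) (hs : ∀ z, ‖z‖ ≤ r → D z ≠ 0 → z ∈ s) :
    logCounting D r = ∑ z ∈ s, (D z : ℝ) * countingWeight r z := by
  classical
  simp only [Function.locallyFinsuppWithin.logCounting, AddMonoidHom.coe_mk, ZeroHom.coe_mk]
  rw [finsum_eq_sum_of_support_subset (s := s)]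
  · have h0 : (D 0 : ℝ) * Real.log r = ∑ z ∈ s, if z = 0 then (D 0 : ℝ) * Real.log r else 0 := by
      rw [Finset.sum_ite_eq']
      split_ifs with h
      · rfl
      · have : D 0 = 0 := by
          by_contra h'
          exact h (hs 0 (by simpa using hr.le) h')
        simp [this]
    rw [h0, ← Finset.sum_add_distrib]
    refine Finset.sum_congr rfl fun z _ ↦ ?_
    unfold countingWeight
    by_cases hz : z = 0
    · simp [hz]
    simp only [hz, if_false, add_zero]
    have hz' : 0 < ‖z‖ := norm_pos_iff.2 hz
    by_cases hzr : ‖z‖ ≤ r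
    · rw [toClosedBall_eval_within _ (by simpa [abs_of_pos hr] using hzr),
        Real.posLog_eq_log]
      rw [abs_of_pos (by positivity), ← div_eq_mul_inv, one_le_div hz']
      exact hzr
    · rw [Function.locallyFinsuppWithin.apply_eq_zero_of_notMem _
        (by simpa [abs_of_pos hr] using hzr), (Real.posLog_eq_zero_iff _).2]
      · simp
      · rw [abs_of_pos (by positivity), ← div_eq_mul_inv, div_le_one hz']
        exact (not_le.1 hzr).le
  · intro z hz
    have h1 : toClosedBall r D z ≠ 0 := by
      intro h; simp [h] at hz
    have h2 : z ∈ closedBall (0 : ℂ) |r| := by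
      by_contra h
      exact h1 (Function.locallyFinsuppWithin.apply_eq_zero_of_notMem _ h)
    rw [toClosedBall_eval_within _ h2] at h1
    exact hs z (by simpa [abs_of_pos hr] using h2) h1

/-- For c ≠ 0 the weight of z - c blows up as z → c while that of z stays bounded; subtracting the
weight at radius 1 cancels the singularity. If ‖z - c‖ ≤ 1 the difference is exactly log r;
otherwise ‖z‖ ≤ (1 + ‖c‖)‖z - c‖. -/
theorem countingWeight_sub_le (c z : ℂ) {r : ℝ} (hr : 1 ≤ r) :
    countingWeight r (z - c) - countingWeight 1 (z - c) ≤ countingWeight ((1 + ‖c‖) * r) z := by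
  have hc := norm_nonneg c
  have hR : 1 ≤ (1 + ‖c‖) * r := by nlinarith
  have hr0 : 0 < r := by linarith
  have hlogr : 0 ≤ Real.log r := Real.log_nonneg hr
  have key : ∀ z : ℂ, ‖z‖ ≤ 1 + ‖c‖ → Real.log r ≤ countingWeight ((1 + ‖c‖) * r) z := by
    intro z hz
    unfold countingWeight
    split_ifs with h0
    · exact Real.log_le_log hr0 (by nlinarith)
    · have hz' : 0 < ‖z‖ := norm_pos_iff.2 h0
      refine le_trans (Real.log_le_log hr0 ?_) (le_max_right _ _)
      rw [← div_eq_mul_inv, le_div_iff₀ hz']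
      nlinarith
  by_cases hu : z = c
  · subst hu
    simp only [sub_self, countingWeight, if_true, Real.log_one, sub_zero]
    exact key z (by linarith)
  have hu' : z - c ≠ 0 := sub_ne_zero.2 hu
  have hun : 0 < ‖z - c‖ := norm_pos_iff.2 hu'
  have hzn : ‖z‖ ≤ ‖z - c‖ + ‖c‖ := by simpa using norm_add_le (z - c) c
  rw [countingWeight, countingWeight, if_neg hu', if_neg hu']
  rcases le_total 1 ‖z - c‖ with h1 | h1
  · have hz1 : ‖z‖ ≤ (1 + ‖c‖) * ‖z - c‖ := by nlinarith
    refine le_trans (sub_le_self _ Real.posLog_nonneg) ?_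
    unfold countingWeight
    split_ifs with h0
    · rw [Real.posLog_def]
      refine max_le (Real.log_nonneg hR) (Real.log_le_log (by positivity) ?_)
      rw [← div_eq_mul_inv, div_le_iff₀ hun]
      nlinarith
    · have hz' : 0 < ‖z‖ := norm_pos_iff.2 h0
      refine Real.posLog_le_posLog (by positivity) ?_
      rw [← div_eq_mul_inv, ← div_eq_mul_inv, div_le_div_iff₀ hun hz']
      nlinarith
  · refine le_trans (le_of_eq ?_) (key z (by linarith))
    have hinv : 1 ≤ ‖z - c‖⁻¹ := (one_le_inv₀ hun).2 h1
    rw [Real.posLog_eq_log, Real.posLog_eq_log, Real.log_mul, Real.log_mul] <;>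
      first | positivity | skip
    · simp
    · rw [abs_of_pos (by positivity)]; simpa using hinv
    · rw [abs_of_pos (by positivity)]; nlinarith

theorem logCounting_translate_sub_le {D D' : Function.locallyFinsupp ℂ ℤ} (hD : 0 ≤ D) {c : ℂ}
    (hDD' : ∀ z, D' (z - c) = D z) {r : ℝ} (hr : 1 ≤ r) :
    logCounting D' r - logCounting D' 1 ≤ logCounting D ((1 + ‖c‖) * r) := by
  classical
  have hc := norm_nonneg c
  have hR : 0 < (1 + ‖c‖) * r := by positivity
  set R := (1 + ‖c‖) * r with hRdef
  have hfin : (toClosedBall R D).support.Finite :=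
    (toClosedBall R D).finiteSupport (isCompact_closedBall 0 |R|)
  set s := hfin.toFinset with hsdef
  have hs : ∀ z, ‖z‖ ≤ R → D z ≠ 0 → z ∈ s := by
    intro z hz hDz
    have hz' : z ∈ closedBall (0 : ℂ) |R| := by simpa [abs_of_pos hR] using hz
    rw [hsdef, Set.Finite.mem_toFinset, Function.mem_support, toClosedBall_eval_within _ hz']
    exact hDz
  have hs' : ∀ ρ : ℝ, ρ ≤ r → ∀ z, ‖z‖ ≤ ρ → D' z ≠ 0 → z ∈ s.image (· - c) := by
    intro ρ hρ z hz hDz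
    refine Finset.mem_image.2 ⟨z + c, hs _ ?_ ?_, by simp⟩
    · refine (norm_add_le _ _).trans ?_
      rw [hRdef]; nlinarith
    · rw [← hDD']; simpa using hDz
  rw [logCounting_eq_sum_countingWeight D hR s hs,
    logCounting_eq_sum_countingWeight D' (by linarith) _ (hs' r le_rfl),
    logCounting_eq_sum_countingWeight D' one_pos _ (hs' 1 hr),
    Finset.sum_image (by intro a _ b _ h; simpa using h),
    Finset.sum_image (by intro a _ b _ h; simpa using h), ← Finset.sum_sub_distrib]
  refine Finset.sum_le_sum fun z _ ↦ ?_
  rw [hDD', ← mul_sub]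
  exact mul_le_mul_of_nonneg_left (countingWeight_sub_le c z hr) (Int.cast_nonneg (hD z))

theorem logCounting_comp_add_sub_le {f : ℂ → ℂ} (c a : ℂ) {r : ℝ} (hr : 1 ≤ r) :
    ValueDistribution.logCounting (fun z ↦ f (z + c)) a r
      - ValueDistribution.logCounting (fun z ↦ f (z + c)) a 1
      ≤ ValueDistribution.logCounting f a ((1 + ‖c‖) * r) := by
  rw [logCounting_coe, logCounting_coe]
  refine logCounting_translate_sub_le (posPart_nonneg _) (fun z ↦ ?_) hr
  have h := divisor_comp_add_const_eq_divisor (𝕜 := ℂ) (U := Set.univ) (c := c) (x := z)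
    (f := fun z ↦ f z - a)
  have hU : (Set.univ + {c} : Set ℂ) = Set.univ :=
    Set.eq_univ_of_forall fun z ↦ ⟨z - c, Set.mem_univ _, c, rfl, by simp⟩
  rw [hU] at h
  simp only [posPart_apply]
  congr 1

/-- The characteristic of a translate is controlled by the characteristic on a larger disc. -/
theorem exists_characteristic_comp_add_le {f : ℂ → ℂ} (hf : Meromorphic f) (c : ℂ) :
    ∃ K, ∀ r, 1 ≤ r → characteristic (fun z ↦ f (z + c)) ⊤ r
      ≤ characteristic f ⊤ ((1 + ‖c‖) * r) + K := by
  have hg : Meromorphic (fun z ↦ f (z + c)) := by simpa using hf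
  -- Cartan's formula: up to a constant, T(r, f) is the mean over |a| = 1 of the counting functions
  -- of the a-points. Averaging turns the terms at radius 1 into a constant.
  obtain ⟨K₁, h₁⟩ := characteristic_top_eq_circleAverage_add_const hf
  obtain ⟨K₂, h₂⟩ := characteristic_top_eq_circleAverage_add_const hg
  refine ⟨circleAverage (ValueDistribution.logCounting (fun z ↦ f (z + c)) · 1) 0 1 + K₂ - K₁,
    fun r hr ↦ ?_⟩
  have hc := norm_nonneg c
  rw [h₁ _ (by positivity), h₂ _ (by positivity)]
  have hmono := circleAverage_mono (c := 0) (R := 1)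
    ((circleIntegrable_logCounting (R := r) hg).sub (circleIntegrable_logCounting (R := 1) hg))
    (circleIntegrable_logCounting (R := (1 + ‖c‖) * r) hf)
    (fun a _ ↦ logCounting_comp_add_sub_le c a hr)
  have := circleAverage_fun_sub (circleIntegrable_logCounting (R := r) hg)
    (circleIntegrable_logCounting (R := 1) hg)
  simp only [Pi.sub_def] at hmono
  rw [this] at hmono
  linarith

/-! ### Characteristics are eventually constant or unbounded -/

theorem log_le_logCounting_of_one_le {D : Function.locallyFinsupp ℂ ℤ} (hD : 0 ≤ D)
    (h0 : 1 ≤ D 0) {r : ℝ} (hr : 1 ≤ r) :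
    Real.log r ≤ Function.locallyFinsuppWithin.logCounting D r := by
  classical
  have h1 : Function.locallyFinsuppWithin.single (0 : ℂ) 1 ≤ D := by
    intro z
    rw [Function.locallyFinsuppWithin.single_apply]
    split_ifs with hz
    · rw [hz]; exact h0
    · exact hD z
  have h2 := logCounting_le h1 hr
  rw [logCounting_single_eq_log_sub_const (by simpa using by linarith)] at h2
  simpa using h2

theorem characteristic_const (a : ℂ) (r : ℝ) :
    characteristic (fun _ : ℂ ↦ a) ⊤ r = log⁺ ‖a‖ := by
  simp [characteristic]

theorem exists_meromorphicOrderAt_sub_const_pos {f : ℂ → ℂ} (hf : Meromorphic f)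
    (h0 : 0 ≤ meromorphicOrderAt f 0) :
    ∃ a, 0 < meromorphicOrderAt (fun z ↦ f z - a) 0 := by
  obtain ⟨a, ha⟩ := tendsto_nhds_of_meromorphicOrderAt_nonneg (hf 0) h0
  refine ⟨a, (tendsto_zero_iff_meromorphicOrderAt_pos (by fun_prop)).1 ?_⟩
  simpa using ha.sub_const a

theorem eventuallyEq_codiscrete_of_meromorphicOrderAt_eq_top {f : ℂ → ℂ} (hf : Meromorphic f)
    {z₀ : ℂ} (h : meromorphicOrderAt f z₀ = ⊤) : f =ᶠ[codiscrete ℂ] 0 := by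
  have htop : ∀ z, meromorphicOrderAt f z = ⊤ := by
    intro z
    by_contra hz
    exact (hf.meromorphicOn (s := Set.univ)).meromorphicOrderAt_ne_top_of_isPreconnected
      isPreconnected_univ (Set.mem_univ z) (Set.mem_univ z₀) hz h
  rw [EventuallyEq, Filter.Eventually, codiscrete, mem_codiscreteWithin_iff_forall_mem_nhdsNE]
  intro z _
  filter_upwards [meromorphicOrderAt_eq_top_iff.1 (htop z)] with w hw
  simpa using hw

/-- The characteristic of a meromorphic function is eventually constant or tends to infinity. -/
theorem tendsto_characteristic_or_eventually_eq_const {f : ℂ → ℂ} (hf : Meromorphic f) :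
    Tendsto (characteristic f ⊤) atTop atTop ∨
      ∃ C, ∀ᶠ r in atTop, characteristic f ⊤ r = C := by
  by_cases hneg : meromorphicOrderAt f 0 < 0
  · left
    refine tendsto_atTop_mono' _ ?_ tendsto_log_atTop
    filter_upwards [eventually_ge_atTop 1] with r hr
    have h1 : Real.log r ≤ ValueDistribution.logCounting f ⊤ r := by
      rw [logCounting_top]
      refine log_le_logCounting_of_one_le (negPart_nonneg _) ?_ hr
      rw [negPart_apply, divisor_apply hf.meromorphicOn (Set.mem_univ _)]
      obtain ⟨n, hn⟩ := WithTop.ne_top_iff_exists.1 hneg.ne_top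
      rw [← hn] at hneg ⊢
      have : n < 0 := by exact_mod_cast hneg
      simp only [WithTop.untop₀_coe, negPart_def]
      omega
    have h2 : 0 ≤ proximity f ⊤ r := proximity_nonneg r
    simp only [characteristic, Pi.add_apply]
    linarith
  -- Without a pole at 0, let a be the limit of f there. Either f is the constant a, or 1/(f - a)
  -- has a pole at 0 and the first main theorem carries its growth over to f.
  obtain ⟨a, ha⟩ := exists_meromorphicOrderAt_sub_const_pos hf (not_lt.1 hneg)
  have hg : Meromorphic (fun z ↦ f z - a) := by fun_prop
  by_cases htop : meromorphicOrderAt (fun z ↦ f z - a) 0 = ⊤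
  · right
    have h1 : f =ᶠ[codiscrete ℂ] fun _ ↦ a := by
      filter_upwards [eventuallyEq_codiscrete_of_meromorphicOrderAt_eq_top hg htop] with z hz
      simpa [sub_eq_zero] using hz
    refine ⟨log⁺ ‖a‖, ?_⟩
    filter_upwards [eventually_ne_atTop 0] with r hr
    rw [characteristic_congr_codiscrete h1 hr, characteristic_const]
  · left
    obtain ⟨K, hK⟩ : ∃ K, ∀ r, 1 ≤ r → Real.log r - K ≤ characteristic f ⊤ r := by
      refine ⟨max |Real.log ‖f 0 - a‖| |Real.log ‖meromorphicTrailingCoeffAt (fun z ↦ f z - a) 0‖|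
        + (log⁺ ‖a‖ + Real.log 2), fun r hr ↦ ?_⟩
      have h1 := abs_le.1 (abs_characteristic_sub_characteristic_shift_le (a₀ := a) (r := r) hf)
      have h2 := abs_le.1 (characteristic_sub_characteristic_inv_le (R := r) hg)
      have h3 : Real.log r ≤ characteristic (fun z ↦ f z - a)⁻¹ ⊤ r := by
        have h4 : Real.log r ≤ ValueDistribution.logCounting (fun z ↦ f z - a)⁻¹ ⊤ r := by
          rw [logCounting_inv, logCounting_zero]
          refine log_le_logCounting_of_one_le (posPart_nonneg _) ?_ hr
          rw [posPart_apply, divisor_apply hg.meromorphicOn (Set.mem_univ _)]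
          obtain ⟨n, hn⟩ := WithTop.ne_top_iff_exists.1 htop
          rw [← hn] at ha ⊢
          have : 0 < n := by exact_mod_cast ha
          simp only [WithTop.untop₀_coe, posPart_def]
          omega
        have h5 : 0 ≤ proximity (fun z ↦ f z - a)⁻¹ ⊤ r := proximity_nonneg r
        simp only [characteristic, Pi.add_apply]
        linarith
      linarith [h1.1, h2.1]
    refine tendsto_atTop_mono' _ ?_ (tendsto_atTop_add_const_right _ (-K) tendsto_log_atTop)
    filter_upwards [eventually_ge_atTop 1] with r hr
    linarith [hK r hr]

/-! ### The inequality between characteristics given by the equation -/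

theorem meromorphicOrderAt_ne_top_of_not_eventuallyEq_zero {f : ℂ → ℂ} (hf : Meromorphic f)
    (h : ¬ f =ᶠ[codiscrete ℂ] 0) (z : ℂ) : meromorphicOrderAt f z ≠ ⊤ :=
  fun hz ↦ h (eventuallyEq_codiscrete_of_meromorphicOrderAt_eq_top hf hz)

/-- Coefficients may vanish identically; the product then has characteristic 0, and the right side
is nonnegative because r ≥ 1. -/
theorem characteristic_mul_le {f g : ℂ → ℂ} (hf : Meromorphic f) (hg : Meromorphic g) {r : ℝ}
    (hr : 1 ≤ r) :
    characteristic (f * g) ⊤ r ≤ characteristic f ⊤ r + characteristic g ⊤ r := by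
  by_cases h : f * g =ᶠ[codiscrete ℂ] fun _ ↦ 0
  · rw [characteristic_congr_codiscrete h (by linarith), characteristic_const]
    simpa using add_nonneg (characteristic_nonneg (f := f) (a := ⊤) hr)
      (characteristic_nonneg (f := g) (a := ⊤) hr)
  · have hf0 : ¬ f =ᶠ[codiscrete ℂ] 0 := by
      intro h'
      exact h (by filter_upwards [h'] with z hz; simp [hz])
    have hg0 : ¬ g =ᶠ[codiscrete ℂ] 0 := by
      intro h'
      exact h (by filter_upwards [h'] with z hz; simp [hz])
    exact characteristic_mul_top_le hr hf (meromorphicOrderAt_ne_top_of_not_eventuallyEq_zero hf hf0)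
      hg (meromorphicOrderAt_ne_top_of_not_eventuallyEq_zero hg hg0)

theorem eventually_codiscrete_comp_add_ne_zero {f : ℂ → ℂ} (hf : Meromorphic f)
    (h : ¬ f =ᶠ[codiscrete ℂ] 0) (c : ℂ) : ∀ᶠ z in codiscrete ℂ, f (z + c) ≠ 0 := by
  have hg : Meromorphic (fun z ↦ f (z + c)) := by simpa using hf
  refine (hg.meromorphicOn (s := Set.univ)).eventually_codiscreteWithin_apply_ne_zero fun z _ ↦ ?_
  rw [meromorphicOrderAt_fun_comp_add_const_eq_meromorphicOrderAt]
  exact meromorphicOrderAt_ne_top_of_not_eventuallyEq_zero hf h _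

/-- If `∑ A j * g j` vanishes identically and `g l` does not, then the characteristic of `A l` is
at most the sum of those of the other coefficients and of all the `g j`, up to a constant. -/
theorem exists_characteristic_le_of_sum_mul_eq_zero {ι : Type*} [DecidableEq ι] (s : Finset ι) {l : ι}
    (hl : l ∈ s) {A g : ι → ℂ → ℂ} (hA : ∀ j ∈ s, Meromorphic (A j))
    (hg : ∀ j ∈ s, Meromorphic (g j)) (hgl : ∀ᶠ z in codiscrete ℂ, g l z ≠ 0)
    (hsum : ∀ᶠ z in codiscrete ℂ, ∑ j ∈ s, A j z * g j z = 0) :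
    ∃ K, ∀ r, 1 ≤ r → characteristic (A l) ⊤ r ≤
      ∑ j ∈ s.erase l, characteristic (A j) ⊤ r + ∑ j ∈ s, characteristic (g j) ⊤ r + K := by
  -- The logarithm is the cost of a sum, the maximum that of replacing g_l by its inverse (first
  -- main theorem).
  refine ⟨Real.log (s.erase l).card +
    max |Real.log ‖g l 0‖| |Real.log ‖meromorphicTrailingCoeffAt (g l) 0‖|, fun r hr ↦ ?_⟩
  have hA' : ∀ j ∈ s.erase l, Meromorphic (A j) := fun j hj ↦ hA j (Finset.mem_of_mem_erase hj)
  have hg' : ∀ j ∈ s.erase l, Meromorphic (g j) := fun j hj ↦ hg j (Finset.mem_of_mem_erase hj)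
  have hAg : ∀ j ∈ s.erase l, Meromorphic (A j * g j) := fun j hj ↦ (hA' j hj).mul (hg' j hj)
  have heq : A l =ᶠ[codiscrete ℂ] (∑ j ∈ s.erase l, A j * g j) * ((g l)⁻¹ * fun _ ↦ -1) := by
    filter_upwards [hgl, hsum] with z h1 h2
    rw [← Finset.add_sum_erase s _ hl] at h2
    simp only [Pi.mul_apply, Finset.sum_apply, Pi.inv_apply]
    rw [← eq_neg_iff_add_eq_zero] at h2
    field_simp
    linear_combination h2
  have hS : Meromorphic (∑ j ∈ s.erase l, A j * g j) := Meromorphic.sum hAg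
  have hm1 : Meromorphic (fun _ : ℂ ↦ (-1 : ℂ)) := fun z ↦ by fun_prop
  rw [characteristic_congr_codiscrete heq (by linarith)]
  have h1 := characteristic_mul_le hS ((hg l hl).inv.mul hm1) hr
  have h2 := characteristic_mul_le (hg l hl).inv hm1 hr
  have h3 := characteristic_sum_top_le _ _ hAg hr
  have h4 := abs_le.1 (characteristic_sub_characteristic_inv_le (R := r) (hg l hl))
  have h5 : ∑ j ∈ s.erase l, characteristic (A j * g j) ⊤ r ≤
      ∑ j ∈ s.erase l, characteristic (A j) ⊤ r + ∑ j ∈ s.erase l, characteristic (g j) ⊤ r := by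
    rw [← Finset.sum_add_distrib]
    exact Finset.sum_le_sum fun j hj ↦ characteristic_mul_le (hA' j hj) (hg' j hj) hr
  rw [characteristic_const] at h2
  rw [Finset.sum_apply] at h3
  rw [← Finset.add_sum_erase s (fun j ↦ characteristic (g j) ⊤ r) hl]
  simp only [norm_neg, norm_one, Real.posLog_one] at h2
  linarith [h4.1]

/-- Treating A_{k+1} as the coefficient of the constant function -1 makes the equation homogeneous,
so l = k + 1 and A_{k+1} ≡ 0 are no special cases. -/
theorem exists_nevanlinnaT_coeff_le {k l : ℕ} (hl : l ≤ k + 1) {A : ℕ → ℂ → ℂ}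
    (hA : ∀ j ≤ k + 1, Meromorphic (A j)) {c : ℕ → ℂ} {f : ℂ → ℂ} (hf : Meromorphic f)
    (hf0 : ¬ f =ᶠ[codiscrete ℂ] 0) (hsol : SolvesDifferenceEquation k A c f) :
    ∃ C > 0, ∃ K ≥ 0, ∀ r, 1 ≤ r → nevanlinnaT (A l) r ≤
      ∑ j ∈ (Finset.range (k + 2)).erase l, nevanlinnaT (A j) r + K * nevanlinnaT f (C * r) + K := by
  -- The value `c 0` is arbitrary, whereas A_0 multiplies the unshifted f.
  set d : ℕ → ℂ := fun j ↦ if j = 0 then 0 else c j with hd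
  set g : ℕ → ℂ → ℂ := fun j ↦ if j = k + 1 then fun _ ↦ -1 else fun z ↦ f (z + d j) with hgdef
  have hm1 : Meromorphic (fun _ : ℂ ↦ (-1 : ℂ)) := fun z ↦ by fun_prop
  have hg : ∀ j, Meromorphic (g j) := by
    intro j
    simp only [hgdef]
    split_ifs
    · exact hm1
    · simpa using hf
  have hg0 : ∀ j, ∀ᶠ z in codiscrete ℂ, g j z ≠ 0 := by
    intro j
    simp only [hgdef]
    split_ifs
    · simp
    · exact eventually_codiscrete_comp_add_ne_zero hf hf0 _
  have hrange : Finset.range (k + 2) = insert (k + 1) (insert 0 (Finset.Icc 1 k)) := by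
    ext j; simp only [Finset.mem_range, Finset.mem_insert, Finset.mem_Icc]; omega
  have hsum : ∀ᶠ z in codiscrete ℂ, ∑ j ∈ Finset.range (k + 2), A j z * g j z = 0 := by
    filter_upwards [hsol] with z hz
    rw [hrange, Finset.sum_insert (by simp), Finset.sum_insert (by simp)]
    have h1 : ∑ j ∈ Finset.Icc 1 k, A j z * g j z = ∑ j ∈ Finset.Icc 1 k, A j z * f (z + c j) := by
      refine Finset.sum_congr rfl fun j hj ↦ ?_
      rw [Finset.mem_Icc] at hj
      have h1 : j ≠ k + 1 := by omega
      have h2 : j ≠ 0 := by omega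
      simp [hgdef, hd, h1, h2]
    have h2 : g (k + 1) z = -1 := by simp [hgdef]
    have h3 : g 0 z = f z := by simp [hgdef, hd]
    rw [h1, h2, h3]
    linear_combination hz
  obtain ⟨K, hK⟩ := exists_characteristic_le_of_sum_mul_eq_zero (Finset.range (k + 2)) (l := l)
    (by simp only [Finset.mem_range]; omega) (A := A) (g := g)
    (fun j hj ↦ hA j (by simp only [Finset.mem_range] at hj; omega)) (fun j _ ↦ hg j) (hg0 l) hsum
  set C := 1 + ∑ j ∈ Finset.range (k + 2), ‖d j‖ with hC
  have hsum0 : 0 ≤ ∑ j ∈ Finset.range (k + 2), ‖d j‖ :=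
    Finset.sum_nonneg fun _ _ ↦ norm_nonneg _
  have hC1 : 1 ≤ C := by rw [hC]; linarith
  have hgK : ∀ j ∈ Finset.range (k + 2), ∃ K, ∀ r, 1 ≤ r →
      characteristic (g j) ⊤ r ≤ characteristic f ⊤ (C * r) + K := by
    intro j hj
    by_cases h : j = k + 1
    · refine ⟨0, fun r hr ↦ ?_⟩
      simp only [hgdef, h, if_true]
      rw [characteristic_const]
      simpa using characteristic_nonneg (by nlinarith)
    · obtain ⟨K, hK⟩ := exists_characteristic_comp_add_le hf (d j)
      refine ⟨K, fun r hr ↦ ?_⟩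
      have hgj : g j = fun z ↦ f (z + d j) := by simp only [hgdef, h, if_false]
      rw [hgj]
      refine (hK r hr).trans ?_
      have h1 : ‖d j‖ ≤ ∑ j ∈ Finset.range (k + 2), ‖d j‖ :=
        Finset.single_le_sum (f := fun j ↦ ‖d j‖) (fun _ _ ↦ norm_nonneg _) hj
      have h0 := norm_nonneg (d j)
      have := characteristic_monotoneOn hf (a := (1 + ‖d j‖) * r) (b := C * r)
        (by simp only [Set.mem_Ioi]; positivity) (by simp only [Set.mem_Ioi]; positivity)
        (mul_le_mul_of_nonneg_right (by rw [hC]; linarith) (by linarith))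
      linarith
  choose! K' hK' using hgK
  have hsumT : ∀ r, 1 ≤ r → ∑ j ∈ Finset.range (k + 2), characteristic (g j) ⊤ r ≤
      (k + 2 : ℕ) * characteristic f ⊤ (C * r) + ∑ j ∈ Finset.range (k + 2), K' j := by
    intro r hr
    refine (Finset.sum_le_sum fun j hj ↦ hK' j hj r hr).trans ?_
    rw [Finset.sum_add_distrib, Finset.sum_const, Finset.card_range, nsmul_eq_mul]
  set K'' := max ((k + 2 : ℕ) : ℝ) (∑ j ∈ Finset.range (k + 2), K' j + K)
  refine ⟨C, by linarith, K'', le_max_of_le_left (by positivity), fun r hr ↦ ?_⟩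
  have h1 := hK r hr
  have h2 := hsumT r hr
  have h3 : ((k + 2 : ℕ) : ℝ) * characteristic f ⊤ (C * r) ≤ K'' * characteristic f ⊤ (C * r) :=
    mul_le_mul_of_nonneg_right (le_max_left _ _) (characteristic_nonneg (by nlinarith))
  have h4 : ∑ j ∈ Finset.range (k + 2), K' j + K ≤ K'' := le_max_right _ _
  simp only [nevanlinnaT]
  linarith

/-! ### Bounds on T from orders and types -/

theorem constOrTendsto_nevanlinnaT {f : ℂ → ℂ} (hf : Meromorphic f) :
    ConstOrTendsto (nevanlinnaT f) :=
  tendsto_characteristic_or_eventually_eq_const hf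

section Growth

variable {n s : ℕ} {f : ℂ → ℂ}

theorem tendsto_mul_iterLog_rpow (s : ℕ) {ν σ : ℝ} (hν : 0 < ν) (hσ : 0 < σ) :
    Tendsto (fun r ↦ σ * iterLog s r ^ ν) atTop atTop :=
  (tendsto_iterLog_rpow s hν).const_mul_atTop hσ

/-- The ratio bound is assumed radius by radius, so that it can come from a limsup (all large r) or
from a liminf (arbitrarily large r). -/
theorem eventually_nevanlinnaT_le_of_order_ratio_le (hf : Meromorphic f) {β : ℝ} (hβ : 0 < β) :
    ∀ᶠ r in atTop, iterLog (n + 1) (nevanlinnaT f r) / iterLog (s + 1) r ≤ β →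
      nevanlinnaT f r ≤ Real.exp^[n] (iterLog s r ^ β) := by
  have hH : Tendsto (fun r ↦ β * iterLog (s + 1) r) atTop atTop :=
    (tendsto_iterLog_atTop (s + 1)).const_mul_atTop hβ
  filter_upwards [(constOrTendsto_nevanlinnaT hf).eventually_le_of_le (n + 1) hH,
    (tendsto_iterLog_atTop (s + 1)).eventually_gt_atTop 0,
    (tendsto_iterLog_atTop s).eventually_gt_atTop 0] with r h1 h2 h3 h4
  rw [div_le_iff₀ h2] at h4
  have h5 := h1 h4
  rwa [iterLog_succ, iterExp_succ_log_rpow _ h3] at h5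

theorem eventually_nevanlinnaT_le_of_type_ratio_le (hf : Meromorphic f) {ν σ : ℝ} (hν : 0 < ν)
    (hσ : 0 < σ) :
    ∀ᶠ r in atTop, iterLog n (nevanlinnaT f r) / iterLog s r ^ ν ≤ σ →
      nevanlinnaT f r ≤ Real.exp^[n] (σ * iterLog s r ^ ν) := by
  filter_upwards [(constOrTendsto_nevanlinnaT hf).eventually_le_of_le n
      (tendsto_mul_iterLog_rpow s hν hσ),
    (tendsto_iterLog_rpow s hν).eventually_gt_atTop 0] with r h1 h2 h3
  rw [div_le_iff₀ h2] at h3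
  exact h1 h3

theorem eventually_nevanlinnaT_le_of_pqOrder_lt (hf : Meromorphic f) {β : ℝ} (hβ : 0 < β)
    (h : pqOrder (n + 1) (s + 1) f < β) :
    ∀ᶠ r in atTop, nevanlinnaT f r ≤ Real.exp^[n] (iterLog s r ^ β) := by
  filter_upwards [eventually_nevanlinnaT_le_of_order_ratio_le (n := n) (s := s) hf hβ,
    eventually_lt_of_limsup_lt h] with r h1 h2
  exact h1 (EReal.coe_lt_coe_iff.1 h2).le

theorem frequently_nevanlinnaT_le_of_pqLowerOrder_lt (hf : Meromorphic f) {β : ℝ} (hβ : 0 < β)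
    (h : pqLowerOrder (n + 1) (s + 1) f < β) :
    ∃ᶠ r in atTop, nevanlinnaT f r ≤ Real.exp^[n] (iterLog s r ^ β) := by
  refine ((frequently_lt_of_liminf_lt (by isBoundedDefault) h).and_eventually
    (eventually_nevanlinnaT_le_of_order_ratio_le (n := n) (s := s) hf hβ)).mono ?_
  rintro r ⟨h1, h2⟩
  exact h2 (EReal.coe_lt_coe_iff.1 h1).le

theorem exists_real_pos_between {a : EReal} {ν : ℝ} (hν : 0 < ν) (h : a < ν) :
    ∃ β : ℝ, 0 < β ∧ a < β ∧ β < ν := by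
  obtain ⟨β, h1, h2⟩ := EReal.lt_iff_exists_real_btwn.1 (max_lt h (EReal.coe_pos.2 hν))
  exact ⟨β, EReal.coe_pos.1 ((le_max_right _ _).trans_lt h1), (le_max_left _ _).trans_lt h1,
    EReal.coe_lt_coe_iff.1 h2⟩

theorem eventually_iterLog_rpow_le (s : ℕ) {β ν σ : ℝ} (hβν : β < ν) (hσ : 0 < σ) :
    ∀ᶠ r in atTop, iterLog s r ^ β ≤ σ * iterLog s r ^ ν := by
  simpa using eventually_mul_iterLog_rpow_le s (K := 1) hβν hσ

/-- Below order ν the type is irrelevant: a power β < ν is eventually absorbed by any σ > 0. -/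
theorem eventually_nevanlinnaT_le (hf : Meromorphic f) {ν σ : ℝ} (hν : 0 < ν) (hσ : 0 < σ)
    (h : pqOrder (n + 1) (s + 1) f < ν ∨
      pqOrder (n + 1) (s + 1) f = ν ∧ pqType (n + 1) (s + 1) f < σ) :
    ∀ᶠ r in atTop, nevanlinnaT f r ≤ Real.exp^[n] (σ * iterLog s r ^ ν) := by
  rcases h with h | ⟨h, h'⟩
  · obtain ⟨β, hβ, h1, h2⟩ := exists_real_pos_between hν h
    filter_upwards [eventually_nevanlinnaT_le_of_pqOrder_lt hf hβ h1,
      eventually_iterLog_rpow_le s h2 hσ] with r h3 h4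
    exact h3.trans ((strictMono_iterExp n).monotone h4)
  · rw [pqType, h, EReal.toReal_coe, Nat.add_sub_cancel, Nat.add_sub_cancel] at h'
    filter_upwards [eventually_nevanlinnaT_le_of_type_ratio_le (n := n) (s := s) hf hν hσ,
      eventually_lt_of_limsup_lt h'] with r h1 h2
    exact h1 (EReal.coe_lt_coe_iff.1 h2).le

theorem frequently_nevanlinnaT_le (hf : Meromorphic f) {ν σ : ℝ} (hν : 0 < ν) (hσ : 0 < σ)
    (h : pqLowerOrder (n + 1) (s + 1) f < ν ∨
      pqLowerOrder (n + 1) (s + 1) f = ν ∧ pqLowerType (n + 1) (s + 1) f < σ) :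
    ∃ᶠ r in atTop, nevanlinnaT f r ≤ Real.exp^[n] (σ * iterLog s r ^ ν) := by
  rcases h with h | ⟨h, h'⟩
  · obtain ⟨β, hβ, h1, h2⟩ := exists_real_pos_between hν h
    refine ((frequently_nevanlinnaT_le_of_pqLowerOrder_lt hf hβ h1).and_eventually
      (eventually_iterLog_rpow_le s h2 hσ)).mono ?_
    rintro r ⟨h3, h4⟩
    exact h3.trans ((strictMono_iterExp n).monotone h4)
  · rw [pqLowerType, h, EReal.toReal_coe, Nat.add_sub_cancel, Nat.add_sub_cancel] at h'
    refine ((frequently_lt_of_liminf_lt (by isBoundedDefault) h').and_eventually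
      (eventually_nevanlinnaT_le_of_type_ratio_le (n := n) (s := s) hf hν hσ)).mono ?_
    rintro r ⟨h1, h2⟩
    exact h2 (EReal.coe_lt_coe_iff.1 h1).le

theorem eventually_nevanlinnaT_const_mul_le (hs : s ≠ 0) (hf : Meromorphic f) {C ν σ : ℝ}
    (hC : 0 < C) (hν : 0 < ν) (hσ : 0 < σ) (h : pqOrder (n + 1) (s + 1) f < ν) :
    ∀ᶠ r in atTop, nevanlinnaT f (C * r) ≤ Real.exp^[n] (σ * iterLog s r ^ ν) := by
  -- The exponent β bounds T(Cr), raising it to β' absorbs the dilation, and the gap from β' to ν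
  -- absorbs σ.
  obtain ⟨β, hβ, h1, h2⟩ := exists_real_pos_between hν h
  obtain ⟨β', h3, h4⟩ := exists_between h2
  have hCr : Tendsto (fun r : ℝ ↦ C * r) atTop atTop := tendsto_id.const_mul_atTop hC
  filter_upwards [hCr.eventually (eventually_nevanlinnaT_le_of_pqOrder_lt hf hβ h1),
    eventually_iterLog_const_mul_rpow_le hs hC hβ h3, eventually_iterLog_rpow_le s h4 hσ]
    with r h5 h6 h7
  exact h5.trans ((strictMono_iterExp n).monotone (h6.trans h7))

theorem tendsto_const_div_iterLog (s : ℕ) (a : ℝ) :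
    Tendsto (fun r ↦ ((a / iterLog s r : ℝ) : EReal)) atTop (𝓝 0) := by
  have h : Tendsto (fun r ↦ a / iterLog s r) atTop (𝓝 0) :=
    (tendsto_iterLog_atTop s).const_div_atTop a
  exact (continuous_coe_real_ereal.tendsto 0).comp h

theorem tendsto_order_ratio_of_eventually_const {C : ℝ} (p q : ℕ)
    (h : ∀ᶠ r in atTop, nevanlinnaT f r = C) :
    Tendsto (fun r ↦ ((iterLog p (nevanlinnaT f r) / iterLog q r : ℝ) : EReal)) atTop (𝓝 0) := by
  refine (tendsto_const_div_iterLog q (iterLog p C)).congr' ?_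
  filter_upwards [h] with r hr
  rw [hr]

theorem tendsto_nevanlinnaT_of_pqOrder_pos {p q : ℕ} (hf : Meromorphic f) (h : 0 < pqOrder p q f) :
    Tendsto (nevanlinnaT f) atTop atTop := by
  rcases constOrTendsto_nevanlinnaT hf with h1 | ⟨C, hC⟩
  · exact h1
  · rw [pqOrder, (tendsto_order_ratio_of_eventually_const p q hC).limsup_eq] at h
    exact absurd h (lt_irrefl _)

theorem pqLowerOrder_le_pqOrder (p q : ℕ) (f : ℂ → ℂ) : pqLowerOrder p q f ≤ pqOrder p q f :=
  liminf_le_limsup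

theorem tendsto_nevanlinnaT_of_pqLowerOrder_pos {p q : ℕ} (hf : Meromorphic f)
    (h : 0 < pqLowerOrder p q f) : Tendsto (nevanlinnaT f) atTop atTop :=
  tendsto_nevanlinnaT_of_pqOrder_pos hf (h.trans_le (pqLowerOrder_le_pqOrder p q f))

theorem eventually_type_ratio_nonneg (n s : ℕ) (ρ : ℝ) (h : Tendsto (nevanlinnaT f) atTop atTop) :
    ∀ᶠ r in atTop, (0 : EReal) ≤ ((iterLog n (nevanlinnaT f r) / iterLog s r ^ ρ : ℝ) : EReal) := by
  filter_upwards [((tendsto_iterLog_atTop n).comp h).eventually_ge_atTop 0,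
    (tendsto_iterLog_atTop s).eventually_ge_atTop 0] with r h1 h2
  exact EReal.coe_nonneg.2 (div_nonneg h1 (Real.rpow_nonneg h2 _))

theorem pqLowerType_nonneg {p q : ℕ} (hf : Meromorphic f) (h : 0 < pqLowerOrder p q f) :
    0 ≤ pqLowerType p q f :=
  le_liminf_of_le (by isBoundedDefault) (eventually_type_ratio_nonneg _ _ _
    (tendsto_nevanlinnaT_of_pqLowerOrder_pos hf h))

theorem pqType_nonneg {p q : ℕ} (hf : Meromorphic f) (h : 0 < pqOrder p q f) :
    0 ≤ pqType p q f :=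
  (le_liminf_of_le (by isBoundedDefault) (eventually_type_ratio_nonneg _ _ _
    (tendsto_nevanlinnaT_of_pqOrder_pos hf h))).trans liminf_le_limsup

/-- Strictness becomes a factor κ inside the iterated exponential: any κ if the orders differ (here
2), and σ'/σ with σ' between σ and the lower type if they agree. -/
theorem exists_eventually_le_nevanlinnaT (hf : Meromorphic f) {ν σ : ℝ} (hν : 0 < ν) (hσ : 0 < σ)
    (h : ν < pqLowerOrder (n + 1) (s + 1) f ∨
      pqLowerOrder (n + 1) (s + 1) f = ν ∧ σ < pqLowerType (n + 1) (s + 1) f) :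
    ∃ κ > 1, ∀ᶠ r in atTop, Real.exp^[n] (κ * (σ * iterLog s r ^ ν)) ≤ nevanlinnaT f r := by
  have hν' : (0 : EReal) < ν := EReal.coe_pos.2 hν
  have hT : Tendsto (nevanlinnaT f) atTop atTop := by
    refine tendsto_nevanlinnaT_of_pqLowerOrder_pos hf (p := n + 1) (q := s + 1) ?_
    rcases h with h | h
    · exact hν'.trans h
    · rw [h.1]; exact hν'
  rcases h with h | ⟨h, h'⟩
  · obtain ⟨β, h1, h2⟩ := EReal.lt_iff_exists_real_btwn.1 h
    refine ⟨2, one_lt_two, ?_⟩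
    filter_upwards [hT.eventually_le_of_le_iterLog (n + 1) (H := fun r ↦ β * iterLog (s + 1) r),
      eventually_lt_of_lt_liminf h2, (tendsto_iterLog_atTop (s + 1)).eventually_gt_atTop 0,
      (tendsto_iterLog_atTop s).eventually_gt_atTop 0,
      eventually_mul_iterLog_rpow_le s (K := 2 * σ) (EReal.coe_lt_coe_iff.1 h1) one_pos]
      with r h3 h4 h5 h6 h7
    have h8 := h3 ((lt_div_iff₀ h5).1 (EReal.coe_lt_coe_iff.1 h4)).le
    rw [iterLog_succ, iterExp_succ_log_rpow _ h6] at h8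
    refine le_trans ((strictMono_iterExp n).monotone ?_) h8
    linarith
  · rw [pqLowerType, h, EReal.toReal_coe, Nat.add_sub_cancel, Nat.add_sub_cancel] at h'
    obtain ⟨σ', h1, h2⟩ := EReal.lt_iff_exists_real_btwn.1 h'
    refine ⟨σ' / σ, (one_lt_div hσ).2 (EReal.coe_lt_coe_iff.1 h1), ?_⟩
    filter_upwards [hT.eventually_le_of_le_iterLog n (H := fun r ↦ σ' * iterLog s r ^ ν),
      eventually_lt_of_lt_liminf h2, (tendsto_iterLog_rpow s hν).eventually_gt_atTop 0]
      with r h3 h4 h5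
    have h6 : σ' / σ * (σ * iterLog s r ^ ν) = σ' * iterLog s r ^ ν := by field_simp
    rw [h6]
    exact h3 ((lt_div_iff₀ h5).1 (EReal.coe_lt_coe_iff.1 h4)).le

end Growth

/-! ### Comparison at a separating scale -/

theorem false_of_le_sum_of_iterExp_bounds {ι : Type*} {n : ℕ} (hn : n ≠ 0) (S : Finset ι)
    {T : ι → ℝ → ℝ} {l m : ι} {F H : ℝ → ℝ} {κ K : ℝ} (hκ : 1 < κ) (hK : 0 ≤ K)
    (hH : Tendsto H atTop atTop)
    (hl : ∀ᶠ r in atTop, Real.exp^[n] (κ * H r) ≤ T l r)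
    (hm : ∃ᶠ r in atTop, T m r ≤ Real.exp^[n] (H r))
    (hS : ∀ j ∈ S, j ≠ m → ∀ᶠ r in atTop, T j r ≤ Real.exp^[n] (H r))
    (hF : ∀ᶠ r in atTop, F r ≤ Real.exp^[n] (H r))
    (hle : ∀ᶠ r in atTop, T l r ≤ ∑ j ∈ S, T j r + K * F r + K) : False := by
  have hS' : ∀ᶠ r in atTop, ∀ j ∈ S, j ≠ m → T j r ≤ Real.exp^[n] (H r) :=
    (Filter.eventually_all_finset S).2 fun j hj ↦ by
      by_cases h : j = m
      · simp [h]
      · filter_upwards [hS j hj h] with r hr _ using hr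
  -- Only one bound holds merely frequently, so all of them hold at a common r.
  obtain ⟨r, hmr, hlr, hSr, hFr, hler, hr⟩ := (hm.and_eventually (hl.and (hS'.and (hF.and
    (hle.and (hH.eventually (eventually_affine_iterExp_lt hn hκ (S.card + K)))))))).exists
  have h1 : ∑ j ∈ S, T j r ≤ S.card * Real.exp^[n] (H r) := by
    rw [← nsmul_eq_mul]
    refine Finset.sum_le_card_nsmul _ _ _ fun j hj ↦ ?_
    by_cases h : j = m
    · rw [h]; exact hmr
    · exact hSr j hj h
  have h2 : K * F r ≤ K * Real.exp^[n] (H r) := mul_le_mul_of_nonneg_left hFr hK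
  have h3 : (0 : ℝ) ≤ S.card := Nat.cast_nonneg _
  linarith

/-- No solution grows slower than the scale `exp^[n] (σ * (iterLog s r) ^ ν)` if that scale
separates the coefficient `A l` from all the others. -/
theorem le_pqOrder_of_separating_scale {n s k l m : ℕ} (hn : n ≠ 0) (hs : s ≠ 0) (hl : l ≤ k + 1)
    (hm : m ≤ k + 1) {A : ℕ → ℂ → ℂ} (hA : ∀ j ≤ k + 1, Meromorphic (A j)) {c : ℕ → ℂ} {f : ℂ → ℂ}
    (hf : Meromorphic f) (hf0 : ¬ f =ᶠ[codiscrete ℂ] 0) (hsol : SolvesDifferenceEquation k A c f)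
    {ν σ : ℝ} (hν : 0 < ν) (hσ : 0 < σ)
    (hAl : ν < pqLowerOrder (n + 1) (s + 1) (A l) ∨
      pqLowerOrder (n + 1) (s + 1) (A l) = ν ∧ σ < pqLowerType (n + 1) (s + 1) (A l))
    (hAm : pqLowerOrder (n + 1) (s + 1) (A m) < ν ∨
      pqLowerOrder (n + 1) (s + 1) (A m) = ν ∧ pqLowerType (n + 1) (s + 1) (A m) < σ)
    (hAj : ∀ j ∈ Finset.range (k + 2) \ {m, l}, pqOrder (n + 1) (s + 1) (A j) < ν ∨
      pqOrder (n + 1) (s + 1) (A j) = ν ∧ pqType (n + 1) (s + 1) (A j) < σ) :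
    ν ≤ pqOrder (n + 1) (s + 1) f := by
  by_contra! hlt
  obtain ⟨C, hC, K, hK, hle⟩ := exists_nevanlinnaT_coeff_le hl hA hf hf0 hsol
  obtain ⟨κ, hκ, hκl⟩ := exists_eventually_le_nevanlinnaT (hA l hl) hν hσ hAl
  refine false_of_le_sum_of_iterExp_bounds hn ((Finset.range (k + 2)).erase l)
    (T := fun j ↦ nevanlinnaT (A j)) (l := l) (m := m) hκ hK (tendsto_mul_iterLog_rpow s hν hσ) hκl
    (frequently_nevanlinnaT_le (hA m hm) hν hσ hAm) (fun j hj hjm ↦ ?_)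
    (eventually_nevanlinnaT_const_mul_le hs hf hC hν hσ hlt)
    ((eventually_ge_atTop 1).mono hle)
  rw [Finset.mem_erase, Finset.mem_range] at hj
  exact eventually_nevanlinnaT_le (hA j (by omega)) hν hσ
    (hAj j (by simp [hjm, hj.1, hj.2]))

/-- Tied coefficients have positive order, hence T → ∞ and nonnegative types, so a sum of types
dominates each summand. Accordingly v is the type sum, the lower type of A_m, or their total,
depending on which ties occur. -/
theorem exists_type_bound {p q k l m : ℕ} (hm : m ≤ k + 1) {A : ℕ → ℂ → ℂ}
    (hA : ∀ j ≤ k + 1, Meromorphic (A j)) (hpos : 0 < pqLowerOrder p q (A l))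
    (hM : maxOtherOrder p q k m l A ≤ pqLowerOrder p q (A l))
    (htie : pqLowerOrder p q (A l) = pqLowerOrder p q (A m) ∨
      pqLowerOrder p q (A l) = maxOtherOrder p q k m l A)
    (h2 : pqLowerOrder p q (A l) = pqLowerOrder p q (A m) →
      pqLowerType p q (A m) < pqLowerType p q (A l))
    (h3 : pqLowerOrder p q (A l) = maxOtherOrder p q k m l A →
      tiedTypeSum p q k m l A < pqLowerType p q (A l))
    (h4 : pqLowerOrder p q (A l) = pqLowerOrder p q (A m) →
      pqLowerOrder p q (A m) = maxOtherOrder p q k m l A →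
      tiedTypeSum p q k m l A + pqLowerType p q (A m) < pqLowerType p q (A l)) :
    ∃ v : EReal, 0 ≤ v ∧ v < pqLowerType p q (A l) ∧
      (∀ j ∈ Finset.range (k + 2) \ {m, l}, pqOrder p q (A j) = pqLowerOrder p q (A l) →
        pqType p q (A j) ≤ v) ∧
      (pqLowerOrder p q (A m) = pqLowerOrder p q (A l) → pqLowerType p q (A m) ≤ v) := by
  classical
  have hj : ∀ j ∈ Finset.range (k + 2) \ {m, l}, Meromorphic (A j) := fun j hj ↦
    hA j (by simp only [Finset.mem_sdiff, Finset.mem_range] at hj; omega)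
  have htype : ∀ j ∈ Finset.range (k + 2) \ {m, l},
      pqOrder p q (A j) = pqLowerOrder p q (A l) → 0 ≤ pqType p q (A j) := fun j hjS h ↦
    pqType_nonneg (hj j hjS) (h ▸ hpos)
  have hsum0 : 0 ≤ tiedTypeSum p q k m l A :=
    Finset.sum_nonneg fun j hj ↦ htype j (Finset.mem_filter.1 hj).1 (Finset.mem_filter.1 hj).2
  have hle : ∀ j ∈ Finset.range (k + 2) \ {m, l}, pqOrder p q (A j) = pqLowerOrder p q (A l) →
      pqType p q (A j) ≤ tiedTypeSum p q k m l A := by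
    intro j hjS h
    refine Finset.single_le_sum (f := fun j ↦ pqType p q (A j)) (fun i hi ↦ ?_)
      (Finset.mem_filter.2 ⟨hjS, h⟩)
    exact htype i (Finset.mem_filter.1 hi).1 (Finset.mem_filter.1 hi).2
  by_cases hlm : pqLowerOrder p q (A l) = pqLowerOrder p q (A m)
  · have hm0 : 0 ≤ pqLowerType p q (A m) := pqLowerType_nonneg (hA m hm) (hlm ▸ hpos)
    by_cases hlM : pqLowerOrder p q (A l) = maxOtherOrder p q k m l A
    · exact ⟨_, add_nonneg hsum0 hm0, h4 hlm (hlm.symm.trans hlM),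
        fun j hjS h ↦ (hle j hjS h).trans (le_add_of_nonneg_right hm0),
        fun _ ↦ le_add_of_nonneg_left hsum0⟩
    · refine ⟨_, hm0, h2 hlm, fun j hjS h ↦ ?_, fun _ ↦ le_rfl⟩
      refine absurd (le_antisymm ?_ hM) hlM
      rw [← h]
      exact Finset.le_sup (f := fun j ↦ pqOrder p q (A j)) hjS
  · exact ⟨_, hsum0, h3 (htie.resolve_left hlm), hle, fun h ↦ absurd h.symm hlm⟩

end

theorem theorem2 (p q k l m : ℕ) (hq : 2 ≤ q) (hpq : q ≤ p) (hk : 2 ≤ k)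
    (hl : l ≤ k + 1) (hm : m ≤ k + 1)
    (A : ℕ → ℂ → ℂ) (hA : ∀ j ≤ k + 1, Meromorphic (A j))
    (c : ℕ → ℂ) (hc0 : ∀ j ∈ Finset.Icc 1 k, c j ≠ 0)
    (hc : ∀ i ∈ Finset.Icc 1 k, ∀ j ∈ Finset.Icc 1 k, c i = c j → i = j)
    (h1pos : 0 < max (pqLowerOrder p q (A m)) (maxOtherOrder p q k m l A))
    (h1le : max (pqLowerOrder p q (A m)) (maxOtherOrder p q k m l A) ≤ pqLowerOrder p q (A l))
    (h1fin : pqLowerOrder p q (A l) < ⊤)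
    (h2 : pqLowerOrder p q (A l) = pqLowerOrder p q (A m) →
      pqLowerType p q (A m) < pqLowerType p q (A l))
    (h3 : pqLowerOrder p q (A l) = maxOtherOrder p q k m l A →
      tiedTypeSum p q k m l A < pqLowerType p q (A l) ∧ pqLowerType p q (A l) < ⊤)
    (h4 : pqLowerOrder p q (A l) = pqLowerOrder p q (A m) →
      pqLowerOrder p q (A m) = maxOtherOrder p q k m l A →
      tiedTypeSum p q k m l A + pqLowerType p q (A m) < pqLowerType p q (A l) ∧
        pqLowerType p q (A l) < ⊤)
    (h5 : pqPoleExponent p q (A l) < pqLowerOrder p q (A l)) :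
    ∀ f : ℂ → ℂ, Meromorphic f → ¬ (f =ᶠ[Filter.codiscrete ℂ] 0) →
      SolvesDifferenceEquation k A c f →
      pqLowerOrder p q (A l) ≤ pqOrder p q f := by
  intro f hf hf0 hsol
  obtain ⟨n, rfl⟩ : ∃ n, p = n + 1 := ⟨p - 1, by omega⟩
  obtain ⟨s, rfl⟩ : ∃ s, q = s + 1 := ⟨q - 1, by omega⟩
  -- p ≥ 2 lets κ beat affine functions; q ≥ 2 lets the scale absorb the dilation of r.
  have hn : n ≠ 0 := by omega
  have hs : s ≠ 0 := by omega
  have hpos := h1pos.trans_le h1le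
  have hmle := (le_max_left _ _).trans h1le
  have hMle := (le_max_right _ _).trans h1le
  have hjle : ∀ j ∈ Finset.range (k + 2) \ {m, l},
      pqOrder (n + 1) (s + 1) (A j) ≤ maxOtherOrder (n + 1) (s + 1) k m l A := fun j hj ↦
    Finset.le_sup (f := fun j ↦ pqOrder (n + 1) (s + 1) (A j)) hj
  obtain ⟨μ, hμ⟩ : ∃ μ : ℝ, pqLowerOrder (n + 1) (s + 1) (A l) = μ :=
    ⟨_, (EReal.coe_toReal h1fin.ne (EReal.bot_lt_zero.trans hpos).ne').symm⟩
  have hμ0 : 0 < μ := EReal.coe_pos.1 (hμ ▸ hpos)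
  by_cases htie : pqLowerOrder (n + 1) (s + 1) (A l) = pqLowerOrder (n + 1) (s + 1) (A m) ∨
      pqLowerOrder (n + 1) (s + 1) (A l) = maxOtherOrder (n + 1) (s + 1) k m l A
  · obtain ⟨v, hv0, hvl, hvj, hvm⟩ := exists_type_bound hm hA hpos hMle htie h2
      (fun h ↦ (h3 h).1) (fun h h' ↦ (h4 h h').1)
    obtain ⟨σ, hvσ, hσl⟩ := EReal.lt_iff_exists_real_btwn.1 hvl
    rw [hμ] at hmle hMle hvj hvm ⊢
    refine le_pqOrder_of_separating_scale hn hs hl hm hA hf hf0 hsol hμ0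
      (EReal.coe_pos.1 (hv0.trans_lt hvσ)) (Or.inr ⟨hμ, hσl⟩) ?_ fun j hj ↦ ?_
    · exact hmle.lt_or_eq.imp_right fun h ↦ ⟨h, (hvm h).trans_lt hvσ⟩
    · exact ((hjle j hj).trans hMle).lt_or_eq.imp_right fun h ↦ ⟨h, (hvj j hj h).trans_lt hvσ⟩
  · rw [not_or] at htie
    -- Without ties there is room for ν strictly between μ and all competing orders, ρ_f included;
    -- types then play no role and σ = 1.
    by_contra! hlt
    have hlt' : max (max (pqLowerOrder (n + 1) (s + 1) (A m))
        (maxOtherOrder (n + 1) (s + 1) k m l A)) (pqOrder (n + 1) (s + 1) f) < μ := by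
      rw [← hμ]
      exact max_lt (max_lt (lt_of_le_of_ne hmle (Ne.symm htie.1))
        (lt_of_le_of_ne hMle (Ne.symm htie.2))) hlt
    obtain ⟨ν, hν0, h6, h7⟩ := exists_real_pos_between hμ0 hlt'
    have h8 := (le_max_left _ _).trans_lt h6
    refine ((le_max_right _ _).trans_lt h6).not_ge (le_pqOrder_of_separating_scale hn hs hl hm hA hf
      hf0 hsol hν0 one_pos (Or.inl ?_) (Or.inl ((le_max_left _ _).trans_lt h8)) fun j hj ↦
        Or.inl ((hjle j hj).trans_lt ((le_max_right _ _).trans_lt h8)))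
    rw [hμ]
    exact EReal.coe_lt_coe_iff.2 h7
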